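/- Setting. A tabular MDP with horizon $H$ has a finite state set $\mathcal S$ of size $S$, a finite action set $\mathcal A$ of size $A$, a fixed initial state $s_1$, transition laws $P_h(s,a)\in\Delta(\mathcal S)$ and reward laws $R_h(s,a)\in\Delta([0,1])$, $h\in[H]$. A history-dependent policy $\pi$ draws $a_h$ from a law that depends (measurably) on $s_h$ and on $(s_i,a_i,r_i)_{i<h}$; then $r_h\sim R_h(s_h,a_h)$ and $s_{h+1}\sim P_h(s_h,a_h)$, independently. Its return is $R(\pi)=\sum_{h=1}^H r_h$, and returns are normalized if $R(\pi)\in[0,1]$ almost surely for every $\pi$. For $\tau\in(0,1)$ let $\mathrm{CVaR}_\tau(X)=\sup_{b\in\mathbb R}\{b-\tau^{-1}\mathbb E[(b-X)^+]\}$ and $\mathrm{CVaR}^\star_\tau=\sup_\pi \mathrm{CVaR}_\tau(R(\pi))$, over all history-dependent policies. An RL algorithm for $K$ episodes, which may be randomized, chooses for each $k\in[K]$ a history-dependent policy $\pi^k$ from its internal randomness and the trajectories observed in episodes $1,\dots,k-1$ (it has no other information about the reward laws), and $\mathrm{Regret}_\tau(K)=\sum_{k=1}^K\left(\mathrm{CVaR}^\star_\tau-\mathrm{CVaR}_\tau(R(\pi^k))\right)$.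 Statement. Fix $\tau\in(0,1/2)$ and integers $A,H\ge 1$. Let the states be the nodes of the balanced $A$-ary tree with $H$ layers, so that $S=1+A+\dots+A^{H-1}$; in particular $A^{H-1}\le S$, and $S\le 2A^{H-1}$ if $A\ge 2$, that is, $S=\Theta(A^{H-1})$. Let $K\in\mathbb N$ with $$K\ \ge\ \frac{S(A-1)}{8\tau}.$$ Then for every RL algorithm for $K$ episodes there is a tabular MDP on these states, with $A$ actions, horizon $H$ and normalized returns, which starts at the root, in which action $a$ moves deterministically to the $a$-th child, and in which all rewards are $0$ except that each action at each leaf gives a Bernoulli reward, such that the expected regret of the algorithm in this MDP satisfies $$\mathbb E\left[\mathrm{Regret}_\tau(K)\right]\ \ge\ \frac{1}{24e}\sqrt{\frac{S(A-1)K}{\tau}}.$$ -/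

import Mathlib

open MeasureTheory ProbabilityTheory

noncomputable section

namespace CVaRRL

/-- Lower-tail conditional value at risk of a return with law `ν`:
`sup_b (b - τ⁻¹ E[(b - X)⁺])`. -/
def cvar (τ : ℝ) (ν : Measure ℝ) : ℝ :=
  ⨆ b : ℝ, (b - τ⁻¹ * ∫ x, max (b - x) 0 ∂ν)

/-- A tabular episodic MDP with horizon `H`. The time index `h : Fin H` counts from `0`. -/
structure TabularMDP (S A : Type*) (H : ℕ) where
  /-- the fixed initial state -/
  init : S
  /-- the transition distribution at time `h` -/
  P : Fin H → S → A → PMF S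
  /-- the reward distribution at time `h`, a law on `[0,1]` -/
  R : Fin H → S → A → ProbabilityMeasure unitInterval

/-- One time step of an episode: state, action, reward. -/
abbrev Step (S A : Type*) : Type _ := S × A × unitInterval

/-- A trajectory of one episode. -/
abbrev Trajectory (S A : Type*) (H : ℕ) : Type _ := Fin H → Step S A

section Model

variable {S A Θ : Type*} [MeasurableSpace S] [MeasurableSpace A] [MeasurableSpace Θ] {H : ℕ}

/-- A measurable family, indexed by `θ : Θ`, of history-dependent randomized policies: at time `h`
the action is drawn from a law that depends on `θ`, on the `h` earlier steps of the
episode, and on the current state. -/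
structure PolicyFamily (S A Θ : Type*) [MeasurableSpace S] [MeasurableSpace A]
    [MeasurableSpace Θ] (H : ℕ) where
  act : (h : Fin H) → Kernel (Θ × ((Fin h → Step S A) × S)) A
  markov : ∀ h, IsMarkovKernel (act h)

/-- A single history-dependent policy. -/
abbrev Policy (S A : Type*) [MeasurableSpace S] [MeasurableSpace A] (H : ℕ) : Type _ :=
  PolicyFamily S A Unit H

/-- The member of a family of policies with index `θ`. -/
def PolicyFamily.at (π : PolicyFamily S A Θ H) (θ : Θ) : Policy S A H where
  act h := (π.act h).comap (fun x => (θ, x.2)) (by fun_prop)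
  markov h := by
    have := π.markov h
    infer_instance

/-- Append a last entry to a finite sequence. -/
def snoc {X : Type*} {n : ℕ} (f : Fin n → X) (x : X) : Fin (n + 1) → X :=
  Fin.snoc (α := fun _ => X) f x

theorem measurable_snoc {X : Type*} [MeasurableSpace X] {n : ℕ} :
    Measurable (fun p : (Fin n → X) × X => snoc p.1 p.2) := by
  refine measurable_pi_lambda _ fun i => ?_
  refine Fin.lastCases ?_ (fun j => ?_) i
  · simpa [snoc] using measurable_snd
  · simpa [snoc, Function.comp_def] using (measurable_pi_apply j).comp measurable_fst

section Episode

variable [Finite S] [DiscreteMeasurableSpace S] [Finite A] [DiscreteMeasurableSpace A]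

/-- Given the state and the action at time `h`, the reward and the next state are drawn
independently from `R h s a` and `P h s a`. -/
def TabularMDP.stepKernel (M : TabularMDP S A H) (h : Fin H) :
    Kernel (S × A) (unitInterval × S) :=
  Kernel.ofFunOfCountable fun x =>
    (M.R h x.1 x.2 : Measure unitInterval).prod (M.P h x.1 x.2).toMeasure

instance (M : TabularMDP S A H) (h : Fin H) : IsMarkovKernel (M.stepKernel h) :=
  ⟨fun x => by
    change IsProbabilityMeasure
      ((M.R h x.1 x.2 : Measure unitInterval).prod (M.P h x.1 x.2).toMeasure)
    infer_instance⟩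

/-- Add the action, the reward and the next state to a partial episode. -/
def appendStep {n : ℕ} (x : (((Fin n → Step S A) × S) × A) × (unitInterval × S)) :
    (Fin (n + 1) → Step S A) × S :=
  (snoc x.1.1.1 (x.1.1.2, x.1.2, x.2.1), x.2.2)

/-- The law of the first `n` steps of an episode together with the state reached after them, when
the member `θ` of the family `π` is played in `M`. -/
def TabularMDP.prefixKernel (M : TabularMDP S A H) (π : PolicyFamily S A Θ H) :
    (n : ℕ) → n ≤ H → Kernel Θ ((Fin n → Step S A) × S)
  | 0, _ => Kernel.const Θ (Measure.dirac (Fin.elim0, M.init))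
  | n + 1, hn =>
    (((M.prefixKernel π n (Nat.le_of_succ_le hn)) ⊗ₖ (π.act ⟨n, hn⟩)) ⊗ₖ
      ((M.stepKernel ⟨n, hn⟩).comap
        (fun x : Θ × (((Fin n → Step S A) × S) × A) => (x.2.1.2, x.2.2)) (by fun_prop))).map
      appendStep

/-- The law of the trajectory of an episode. -/
def TabularMDP.episodeKernel (M : TabularMDP S A H) (π : PolicyFamily S A Θ H) :
    Kernel Θ (Trajectory S A H) :=
  (M.prefixKernel π H le_rfl).map Prod.fst

/-- The return of a trajectory: the sum of its rewards. -/
def trajectoryReturn (t : Trajectory S A H) : ℝ := ∑ h, ((t h).2.2 : ℝ)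

/-- The law of the return of a history-dependent policy. -/
def TabularMDP.returnLaw (M : TabularMDP S A H) (π : Policy S A H) : Measure ℝ :=
  (M.episodeKernel π ()).map trajectoryReturn

/-- Returns are normalized: under every policy the return lies in `[0,1]` almost surely. -/
def TabularMDP.Normalized (M : TabularMDP S A H) : Prop :=
  ∀ π : Policy S A H, ∀ᵐ x ∂(M.returnLaw π), x ∈ Set.Icc (0 : ℝ) 1

/-- The best CVaR over all history-dependent policies. -/
def TabularMDP.optCVaR (M : TabularMDP S A H) (τ : ℝ) : ℝ :=
  ⨆ π : Policy S A H, cvar τ (M.returnLaw π)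

end Episode

/-- A learning algorithm for `K` episodes, with internal randomness `ω : Ω` (the seed): it chooses
the policy for episode `k` from the seed and from the `k` earlier trajectories. -/
abbrev Algorithm (S A Ω : Type*) [MeasurableSpace S] [MeasurableSpace A] [MeasurableSpace Ω]
    (H K : ℕ) : Type _ :=
  (k : Fin K) → PolicyFamily S A (Ω × (Fin k → Trajectory S A H)) H

section Learning

variable [Finite S] [DiscreteMeasurableSpace S] [Finite A] [DiscreteMeasurableSpace A]
  {Ω : Type*} [MeasurableSpace Ω] {K : ℕ}

/-- The joint law of the seed (drawn from `μ`) and of the first `k` trajectories, when the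
algorithm `alg` is run in `M`. -/
def TabularMDP.learningLaw (M : TabularMDP S A H) (μ : Measure Ω) (alg : Algorithm S A Ω H K) :
    (k : ℕ) → k ≤ K → Measure (Ω × (Fin k → Trajectory S A H))
  | 0, _ => μ.map (fun ω => (ω, Fin.elim0))
  | k + 1, hk =>
    ((M.learningLaw μ alg k (Nat.le_of_succ_le hk)) ⊗ₘ (M.episodeKernel (alg ⟨k, hk⟩))).map
      (fun x => (x.1.1, snoc x.1.2 x.2))

/-- The policy that the algorithm plays in episode `k`, given the seed and the data. -/
def Algorithm.played (alg : Algorithm S A Ω H K) (ω : Ω) (d : Fin K → Trajectory S A H)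
    (k : Fin K) : Policy S A H :=
  (alg k).at (ω, fun i => d (i.castLE k.isLt.le))

/-- The CVaR regret `∑ k, (CVaR* - CVaR(R(πᵏ)))` of one run. -/
def TabularMDP.regret (M : TabularMDP S A H) (τ : ℝ) (alg : Algorithm S A Ω H K)
    (ω : Ω) (d : Fin K → Trajectory S A H) : ℝ :=
  ∑ k : Fin K, (M.optCVaR τ - cvar τ (M.returnLaw (alg.played ω d k)))

/-- The expected CVaR regret of `alg` in `M`. -/
def TabularMDP.expectedRegret (M : TabularMDP S A H) (τ : ℝ) (μ : Measure Ω)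
    (alg : Algorithm S A Ω H K) : ℝ :=
  ∫ x, M.regret τ alg x.1 x.2 ∂(M.learningLaw μ alg K le_rfl)

end Learning

end Model

/-- The nodes of the balanced `A`-ary tree with `H` layers: a node in layer `h` (counted from `0`)
is the sequence of the `h` actions that lead to it from the root. -/
def TreeState (A H : ℕ) : Type := (h : Fin H) × (Fin h → Fin A)

instance (A H : ℕ) : Fintype (TreeState A H) :=
  inferInstanceAs (Fintype ((h : Fin H) × (Fin h → Fin A)))

instance (A H : ℕ) : MeasurableSpace (TreeState A H) := ⊤

instance (A H : ℕ) : DiscreteMeasurableSpace (TreeState A H) := ⟨fun _ => trivial⟩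

/-- The root of the tree. -/
def TreeState.root {A H : ℕ} (hH : 0 < H) : TreeState A H := ⟨⟨0, hH⟩, Fin.elim0⟩

/-- The state reached from `s` by action `a`: the `a`-th child of `s`; a leaf has no child and is
left unchanged (it is only visited at the last time step). -/
def TreeState.child {A H : ℕ} (s : TreeState A H) (a : Fin A) : TreeState A H :=
  if hs : s.1.val + 1 < H then ⟨⟨s.1.val + 1, hs⟩, snoc s.2 a⟩ else s

/-- The tree-structured MDP with actions `Fin A` in which action `a` moves from a node to its `a`-th
child, all rewards before the last layer are `0`, and action `a` at a leaf `s` gives a reward with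
law Bernoulli with success probability `p s a`. -/
def treeMDP {A H : ℕ} (hH : 0 < H) (p : TreeState A H → Fin A → unitInterval) :
    TabularMDP (TreeState A H) (Fin A) H where
  init := TreeState.root hH
  P _ s a := PMF.pure (s.child a)
  R _ s a :=
    if s.1.val + 1 = H then ⟨bernoulliMeasure 1 0 (p s a), inferInstance⟩
    else ⟨Measure.dirac 0, inferInstance⟩

end CVaRRL

end

/-!
In the tree, with only Bernoulli rewards at the leaves, an episode amounts to one pull of a bandit
with `N = A ^ H = S (A - 1) + 1` arms, one for each action at each leaf: the part of the episode
before the last reward carries no information about the success probabilities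
(`prefixKernel_tree_eq`, `lintegral_episodeKernel_tree`). The return is a Bernoulli variable, and
for a success probability `m ≥ 1 - τ` its CVaR is the affine function `1 - (1 - m) / τ`
(`cvar_bernoulli`). If one arm `w` has success probability `1 - τ + ε` and all others `1 - τ`, the
optimal CVaR is therefore `ε / τ`, and the expected regret is `ε / τ` times the expected number of
episodes that do not end with `w` (`expectedRegret_armSuccess`).

The lower bound compares this instance with the base instance, in which every arm has success
probability `1 - τ`. There some arm `w` is played at most `K / N` times in expectation. The data
laws of the two instances differ by the density `L`, a product of one likelihood ratio per episode
(`lintegral_learningLaw_armSuccess`). Instead of relative entropies and Pinsker's inequality, the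
pointwise bound `|L - 1| ≤ 5 (L - 1 - log L) + (L + 1) / 10` is used, and `- log L` is bounded by
the sum of the terms `1 / ℓ - 1` over the likelihood ratios `ℓ` of the episodes
(`abs_prod_sub_one_le`).
In the base instance that sum has expectation `χ` times the expected number of plays of `w`, with
`χ = ε ^ 2 / ((1 - τ + ε) (τ - ε))` (`lintegral_sum_inv_likelihood`). Hence the number of plays of
`w` stays well below `K` when `w` becomes the distinguished arm
(`integral_armCount_armSuccess_le`), for `ε` of order `√(τ (N - 1) / K)`
(`regret_bound_of_gap`). The lower bound on `K` ensures that this `ε` is at most a fraction of `τ`.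
-/

noncomputable section

namespace CVaRRL

/-! ### Laws of episodes and of learning runs -/

section General

variable {S A Θ : Type*} [MeasurableSpace S] [MeasurableSpace A] [MeasurableSpace Θ] {H : ℕ}

/-- The action law at time `n`, with the length of the history written as `n` instead of
as the value of an element of `Fin H`. -/
def PolicyFamily.actAt (π : PolicyFamily S A Θ H) {n : ℕ} (hn : n < H) :
    Kernel (Θ × ((Fin n → Step S A) × S)) A :=
  π.act ⟨n, hn⟩

instance (π : PolicyFamily S A Θ H) {n : ℕ} (hn : n < H) : IsMarkovKernel (π.actAt hn) :=
  π.markov ⟨n, hn⟩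

@[fun_prop]
theorem measurable_appendStep {n : ℕ} :
    Measurable (appendStep (S := S) (A := A) (n := n)) := by
  unfold appendStep
  exact (measurable_snoc.comp (f := fun x : (((Fin n → Step S A) × S) × A) × (unitInterval × S) =>
    (x.1.1.1, (x.1.1.2, x.1.2, x.2.1))) (by fun_prop)).prodMk (by fun_prop)

variable [Finite S] [DiscreteMeasurableSpace S] [Finite A] [DiscreteMeasurableSpace A]

theorem prefixKernel_succ (M : TabularMDP S A H) (π : PolicyFamily S A Θ H) {n : ℕ}
    (hn : n + 1 ≤ H) :
    M.prefixKernel π (n + 1) hn =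
      (((M.prefixKernel π n (Nat.le_of_succ_le hn)) ⊗ₖ (π.actAt hn)) ⊗ₖ
        ((M.stepKernel ⟨n, hn⟩).comap
          (fun x : Θ × (((Fin n → Step S A) × S) × A) => (x.2.1.2, x.2.2)) (by fun_prop))).map
        appendStep :=
  rfl

instance isMarkovKernel_prefixKernel (M : TabularMDP S A H) (π : PolicyFamily S A Θ H) :
    ∀ (n : ℕ) (hn : n ≤ H), IsMarkovKernel (M.prefixKernel π n hn)
  | 0, _ => by
    unfold TabularMDP.prefixKernel
    infer_instance
  | n + 1, hn => by
    have := isMarkovKernel_prefixKernel M π n (Nat.le_of_succ_le hn)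
    rw [prefixKernel_succ]
    exact Kernel.IsMarkovKernel.map _ measurable_appendStep

instance (M : TabularMDP S A H) (π : PolicyFamily S A Θ H) :
    IsMarkovKernel (M.episodeKernel π) :=
  Kernel.IsMarkovKernel.map _ measurable_fst

theorem lintegral_prefixKernel_succ (M : TabularMDP S A H) (π : PolicyFamily S A Θ H) {n : ℕ}
    (hn : n + 1 ≤ H) (θ : Θ) {f : (Fin (n + 1) → Step S A) × S → ENNReal} (hf : Measurable f) :
    ∫⁻ z, f z ∂(M.prefixKernel π (n + 1) hn θ) =
      ∫⁻ x, ∫⁻ a, ∫⁻ y, f (appendStep ((x, a), y)) ∂(M.stepKernel ⟨n, hn⟩ (x.2, a))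
        ∂(π.actAt hn (θ, x)) ∂(M.prefixKernel π n (Nat.le_of_succ_le hn) θ) := by
  have hg : Measurable fun z : (((Fin n → Step S A) × S) × A) × (unitInterval × S) =>
      f (appendStep z) := hf.comp measurable_appendStep
  rw [prefixKernel_succ, Kernel.lintegral_map _ measurable_appendStep _ hf,
    Kernel.lintegral_compProd _ _ _ hg, Kernel.lintegral_compProd]
  · rfl
  · exact (Measurable.lintegral_kernel_prod_right'
      (κ := (M.stepKernel ⟨n, hn⟩).comap
        (fun x : Θ × (((Fin n → Step S A) × S) × A) => (x.2.1.2, x.2.2)) (by fun_prop))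
      (f := fun p => f (appendStep (p.1.2, p.2)))
      (hg.comp (by fun_prop : Measurable fun p : (Θ × (((Fin n → Step S A) × S) × A)) ×
        (unitInterval × S) => (p.1.2, p.2)))).comp measurable_prodMk_left

/-- An almost sure property of partial episodes is checked one step at a time. -/
theorem ae_prefixKernel_succ (M : TabularMDP S A H) (π : PolicyFamily S A Θ H) {n : ℕ}
    (hn : n + 1 ≤ H) (θ : Θ) {P : (Fin (n + 1) → Step S A) × S → Prop}
    (hP : MeasurableSet {z | P z})
    (h : ∀ᵐ x ∂(M.prefixKernel π n (Nat.le_of_succ_le hn) θ), ∀ᵐ a ∂(π.actAt hn (θ, x)),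
      ∀ᵐ y ∂(M.stepKernel ⟨n, hn⟩ (x.2, a)), P (appendStep ((x, a), y))) :
    ∀ᵐ z ∂(M.prefixKernel π (n + 1) hn θ), P z := by
  have hm : Measurable ({z | P z}ᶜ.indicator (1 : (Fin (n + 1) → Step S A) × S → ENNReal)) :=
    measurable_one.indicator hP.compl
  have h0 : ∫⁻ z, {z | P z}ᶜ.indicator (1 : (Fin (n + 1) → Step S A) × S → ENNReal) z
      ∂(M.prefixKernel π (n + 1) hn θ) = 0 := by
    rw [lintegral_prefixKernel_succ M π hn θ hm]
    refine (lintegral_congr_ae ?_).trans lintegral_zero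
    filter_upwards [h] with x hx
    refine (lintegral_congr_ae ?_).trans lintegral_zero
    filter_upwards [hx] with a ha
    refine (lintegral_congr_ae ?_).trans lintegral_zero
    filter_upwards [ha] with y hy
    simp [hy]
  rw [lintegral_indicator_one hP.compl] at h0
  exact h0

theorem prefixKernel_at (M : TabularMDP S A H) (π : PolicyFamily S A Θ H) (θ : Θ) :
    ∀ (n : ℕ) (hn : n ≤ H), M.prefixKernel (π.at θ) n hn () = M.prefixKernel π n hn θ
  | 0, _ => rfl
  | n + 1, hn => by
    refine Measure.ext_of_lintegral _ fun f hf => ?_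
    rw [lintegral_prefixKernel_succ _ _ _ _ hf, lintegral_prefixKernel_succ _ _ _ _ hf,
      prefixKernel_at M π θ n]
    rfl

theorem lintegral_stepKernel (M : TabularMDP S A H) (h : Fin H) (x : S × A)
    {f : unitInterval × S → ENNReal} (hf : Measurable f) :
    ∫⁻ y, f y ∂(M.stepKernel h x) =
      ∫⁻ r, ∫⁻ s, f (r, s) ∂(M.P h x.1 x.2).toMeasure ∂(M.R h x.1 x.2 : Measure unitInterval) := by
  change ∫⁻ y, f y ∂((M.R h x.1 x.2 : Measure unitInterval).prod (M.P h x.1 x.2).toMeasure) = _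
  exact lintegral_prod _ hf.aemeasurable

end General

section Learning

variable {S A Ω : Type*} [MeasurableSpace S] [MeasurableSpace A] [MeasurableSpace Ω] {H K : ℕ}
  [Finite S] [DiscreteMeasurableSpace S] [Finite A] [DiscreteMeasurableSpace A]

theorem measurable_snocTrajectory {k : ℕ} {X : Type*} [MeasurableSpace X] :
    Measurable fun x : (Ω × (Fin k → X)) × X => (x.1.1, snoc x.1.2 x.2) :=
  measurable_fst.fst.prodMk (measurable_snoc.comp (f := fun x : (Ω × (Fin k → X)) × X =>
    (x.1.2, x.2)) (by fun_prop))

instance isProbabilityMeasure_learningLaw (M : TabularMDP S A H) (μ : Measure Ω)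
    [IsProbabilityMeasure μ] (alg : Algorithm S A Ω H K) :
    ∀ (k : ℕ) (hk : k ≤ K), IsProbabilityMeasure (M.learningLaw μ alg k hk)
  | 0, _ => by
    unfold TabularMDP.learningLaw
    exact Measure.isProbabilityMeasure_map (by fun_prop)
  | k + 1, hk => by
    have := isProbabilityMeasure_learningLaw M μ alg k (Nat.le_of_succ_le hk)
    unfold TabularMDP.learningLaw
    exact Measure.isProbabilityMeasure_map measurable_snocTrajectory.aemeasurable

theorem lintegral_learningLaw_succ (M : TabularMDP S A H) (μ : Measure Ω) [IsProbabilityMeasure μ]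
    (alg : Algorithm S A Ω H K) {k : ℕ} (hk : k + 1 ≤ K)
    {f : Ω × (Fin (k + 1) → Trajectory S A H) → ENNReal} (hf : Measurable f) :
    ∫⁻ z, f z ∂(M.learningLaw μ alg (k + 1) hk) =
      ∫⁻ x, ∫⁻ t, f (x.1, snoc x.2 t) ∂(M.episodeKernel (alg ⟨k, hk⟩) x)
        ∂(M.learningLaw μ alg k (Nat.le_of_succ_le hk)) := by
  have hg : Measurable fun z : (Ω × (Fin k → Trajectory S A H)) × Trajectory S A H =>
      f (z.1.1, snoc z.1.2 z.2) := hf.comp measurable_snocTrajectory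
  rw [TabularMDP.learningLaw, lintegral_map hf measurable_snocTrajectory,
    Measure.lintegral_compProd hg]

end Learning

/-! ### Episodes in the tree -/

section Tree

variable {A n : ℕ} {Θ : Type*} [MeasurableSpace Θ]

/-- The layer of a node, counted from `0`. -/
def TreeState.layer {H : ℕ} (s : TreeState A H) : ℕ := s.1.val

theorem TreeState.child_of_layer_lt {H : ℕ} (s : TreeState A H) (a : Fin A)
    (hs : s.layer + 1 < H) : s.child a = ⟨⟨s.layer + 1, hs⟩, snoc s.2 a⟩ :=
  dif_pos hs

/-- The node in layer `m` on the path from the root that follows the actions `w`. -/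
def pathNode (w : Fin (n + 1) → Fin A) (m : ℕ) (hm : m < n + 1) : TreeState A (n + 1) :=
  ⟨⟨m, hm⟩, fun j => w ⟨j, j.2.trans hm⟩⟩

theorem child_pathNode (w : Fin (n + 1) → Fin A) (m : ℕ) (hm : m + 1 < n + 1) :
    (pathNode w m (Nat.lt_of_succ_lt hm)).child (w ⟨m, Nat.lt_of_succ_lt hm⟩) =
      pathNode w (m + 1) hm := by
  rw [TreeState.child_of_layer_lt _ _ hm]
  unfold pathNode TreeState.layer
  congr 1
  funext j
  refine Fin.lastCases ?_ (fun i => ?_) j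
  · simp [snoc]
  · simp [snoc]

/-- A word of `n + 1` actions names an arm: the first `n` actions lead to a leaf, the last one is
played there. -/
def arm (w : Fin (n + 1) → Fin A) : TreeState A (n + 1) × Fin A :=
  (pathNode w n (Nat.lt_succ_self n), w (Fin.last n))

theorem arm_injective : Function.Injective (arm : (Fin (n + 1) → Fin A) → _) := by
  intro v w h
  have h1 : pathNode v n (Nat.lt_succ_self n) = pathNode w n (Nat.lt_succ_self n) :=
    congrArg Prod.fst h
  have h2 : v (Fin.last n) = w (Fin.last n) := congrArg Prod.snd h
  have h3 := eq_of_heq (Sigma.mk.inj h1).2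
  funext j
  refine Fin.lastCases h2 (fun i => ?_) j
  exact congrFun h3 i

theorem lintegral_stepKernel_tree (hH : 0 < n + 1)
    (p : TreeState A (n + 1) → Fin A → unitInterval) (h : Fin (n + 1))
    (x : TreeState A (n + 1) × Fin A) {f : unitInterval × TreeState A (n + 1) → ENNReal}
    (hf : Measurable f) :
    ∫⁻ y, f y ∂((treeMDP hH p).stepKernel h x) =
      if x.1.layer = n then
        ENNReal.ofReal (p x.1 x.2) * f (1, x.1.child x.2) +
          ENNReal.ofReal (1 - p x.1 x.2) * f (0, x.1.child x.2)
      else f (0, x.1.child x.2) := by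
  rw [lintegral_stepKernel _ _ _ hf]
  have hP : ∀ r, ∫⁻ s, f (r, s) ∂((treeMDP hH p).P h x.1 x.2).toMeasure = f (r, x.1.child x.2) := by
    intro r
    change ∫⁻ s, f (r, s) ∂(PMF.pure (x.1.child x.2)).toMeasure = _
    rw [PMF.toMeasure_pure, lintegral_dirac]
  simp_rw [hP]
  have hg : Measurable fun r => f (r, x.1.child x.2) := hf.comp (by fun_prop)
  have hR : ((treeMDP hH p).R h x.1 x.2 : Measure unitInterval) =
      if x.1.layer = n then bernoulliMeasure 1 0 (p x.1 x.2) else Measure.dirac 0 := by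
    unfold treeMDP TreeState.layer
    by_cases hx : x.1.1.val = n
    · simp only [hx, if_true]
      rfl
    · simp only [hx, if_false, Nat.add_right_cancel_iff]
      rfl
  rw [hR]
  split_ifs with h1
  · rw [bernoulliMeasure_def, lintegral_add_measure, lintegral_smul_measure,
      lintegral_smul_measure, lintegral_dirac' _ hg, lintegral_dirac' _ hg]
    simp only [ENNReal.smul_def, smul_eq_mul]
    congr 2
    · rw [ENNReal.ofReal, unitInterval.toNNReal, Real.toNNReal_of_nonneg (p x.1 x.2).2.1]
      rfl
    · rw [ENNReal.ofReal, unitInterval.toNNReal, Real.toNNReal_of_nonneg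
        (by linarith [(p x.1 x.2).2.2])]
      rfl
  · rw [lintegral_dirac' _ hg]

theorem lintegral_prefixKernel_tree (hH : 0 < n + 1)
    (p : TreeState A (n + 1) → Fin A → unitInterval)
    (π : PolicyFamily (TreeState A (n + 1)) (Fin A) Θ (n + 1)) {m : ℕ} (hm : m + 1 ≤ n + 1) (θ : Θ)
    {f : (Fin (m + 1) → Step (TreeState A (n + 1)) (Fin A)) × TreeState A (n + 1) → ENNReal}
    (hf : Measurable f) :
    ∫⁻ z, f z ∂((treeMDP hH p).prefixKernel π (m + 1) hm θ) =
      ∫⁻ x, ∫⁻ a, (if x.2.layer = n then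
          ENNReal.ofReal (p x.2 a) * f (snoc x.1 (x.2, a, 1), x.2.child a) +
            ENNReal.ofReal (1 - p x.2 a) * f (snoc x.1 (x.2, a, 0), x.2.child a)
          else f (snoc x.1 (x.2, a, 0), x.2.child a))
        ∂(π.actAt hm (θ, x)) ∂((treeMDP hH p).prefixKernel π m (Nat.le_of_succ_le hm) θ) := by
  rw [lintegral_prefixKernel_succ _ _ _ _ hf]
  refine lintegral_congr fun x => lintegral_congr fun a => ?_
  rw [lintegral_stepKernel_tree hH p _ _
    (f := fun y => f (appendStep ((x, a), y)))
    (hf.comp (measurable_appendStep.comp measurable_prodMk_left))]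
  rfl

theorem measurableSet_layer (k m : ℕ) :
    MeasurableSet {x : (Fin k → Step (TreeState A (n + 1)) (Fin A)) × TreeState A (n + 1) |
      x.2.layer = m ∧ ∀ j, (x.1 j).2.2 = 0} := by
  have h1 : MeasurableSet {x : (Fin k → Step (TreeState A (n + 1)) (Fin A)) ×
      TreeState A (n + 1) | x.2.layer = m} :=
    measurable_snd (.of_discrete (s := {s : TreeState A (n + 1) | s.layer = m}))
  have h2 : MeasurableSet {x : (Fin k → Step (TreeState A (n + 1)) (Fin A)) ×
      TreeState A (n + 1) | ∀ j, (x.1 j).2.2 = 0} := by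
    rw [Set.ofPred_forall]
    exact MeasurableSet.iInter fun j => measurableSet_eq_fun (by fun_prop) measurable_const
  exact h1.inter h2

theorem ae_stepKernel_of_not_leaf (hH : 0 < n + 1)
    (p : TreeState A (n + 1) → Fin A → unitInterval) (h : Fin (n + 1))
    (x : TreeState A (n + 1) × Fin A) (hx : x.1.layer ≠ n) :
    ∀ᵐ y ∂((treeMDP hH p).stepKernel h x), y = (0, x.1.child x.2) := by
  have hS : MeasurableSet {y : unitInterval × TreeState A (n + 1) | y = (0, x.1.child x.2)} :=
    measurableSet_eq_fun measurable_id measurable_const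
  have := lintegral_stepKernel_tree hH p h x (measurable_one.indicator hS.compl)
  rw [lintegral_indicator_one hS.compl, if_neg hx] at this
  rw [ae_iff]
  exact this.trans (by simp)

/-- Before the last action the partial episode is in the layer that the time dictates, and no
reward has been received. -/
theorem ae_prefixKernel_layer (hH : 0 < n + 1)
    (p : TreeState A (n + 1) → Fin A → unitInterval)
    (π : PolicyFamily (TreeState A (n + 1)) (Fin A) Θ (n + 1)) (θ : Θ) :
    ∀ (m : ℕ) (hm : m ≤ n), ∀ᵐ x ∂((treeMDP hH p).prefixKernel π m (Nat.le_succ_of_le hm) θ),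
      x.2.layer = m ∧ ∀ j, (x.1 j).2.2 = 0
  | 0, _ => by
    change ∀ᵐ x ∂(Measure.dirac (Fin.elim0, TreeState.root hH)), _
    rw [ae_dirac_iff (measurableSet_layer 0 0)]
    exact ⟨rfl, fun j => j.elim0⟩
  | m + 1, hm => by
    refine ae_prefixKernel_succ _ _ _ _ (measurableSet_layer (m + 1) (m + 1)) ?_
    filter_upwards [ae_prefixKernel_layer hH p π θ m (Nat.le_of_succ_le hm)] with x hx
    refine Filter.Eventually.of_forall fun a => ?_
    filter_upwards [ae_stepKernel_of_not_leaf hH p ⟨m, by omega⟩ (x.2, a) (by grind)]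
      with y hy
    subst hy
    refine ⟨?_, fun j => ?_⟩
    · simp only [appendStep]
      rw [TreeState.child_of_layer_lt _ _ (by omega)]
      simp [TreeState.layer, ← hx.1]
    · refine Fin.lastCases ?_ (fun i => ?_) j
      · simp [appendStep, snoc]
      · simpa [appendStep, snoc] using hx.2 i

/-- The rewards sit at the last step, so the law of the earlier steps does not depend on the
success probabilities. -/
theorem prefixKernel_tree_eq (hH : 0 < n + 1)
    (p p' : TreeState A (n + 1) → Fin A → unitInterval)
    (π : PolicyFamily (TreeState A (n + 1)) (Fin A) Θ (n + 1)) (θ : Θ) :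
    ∀ (m : ℕ) (hm : m ≤ n), (treeMDP hH p).prefixKernel π m (Nat.le_succ_of_le hm) θ =
      (treeMDP hH p').prefixKernel π m (Nat.le_succ_of_le hm) θ
  | 0, _ => rfl
  | m + 1, hm => by
    refine Measure.ext_of_lintegral _ fun f hf => ?_
    rw [lintegral_prefixKernel_tree hH _ _ _ _ hf, lintegral_prefixKernel_tree hH _ _ _ _ hf,
      prefixKernel_tree_eq hH p p' π θ m (Nat.le_of_succ_le hm)]
    refine lintegral_congr_ae ?_
    filter_upwards [ae_prefixKernel_layer hH p' π θ m (Nat.le_of_succ_le hm)] with x hx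
    have hx' : x.2.layer ≠ n := by omega
    simp only [hx', if_false]

/-- The law of the first `n` steps together with the leaf reached and the action chosen there. It
is defined with all success probabilities `0`; by `prefixKernel_tree_eq` the choice is
immaterial. -/
def armKernel (π : PolicyFamily (TreeState A (n + 1)) (Fin A) Θ (n + 1)) :
    Kernel Θ (((Fin n → Step (TreeState A (n + 1)) (Fin A)) × TreeState A (n + 1)) × Fin A) :=
  (treeMDP (Nat.succ_pos n) fun _ _ => 0).prefixKernel π n (Nat.le_succ n) ⊗ₖ
    π.actAt (Nat.lt_succ_self n)

instance (π : PolicyFamily (TreeState A (n + 1)) (Fin A) Θ (n + 1)) :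
    IsMarkovKernel (armKernel π) := by
  unfold armKernel
  infer_instance

/-- Integration over an episode: draw the arm, then a Bernoulli reward. -/
theorem lintegral_episodeKernel_tree (hH : 0 < n + 1)
    (p : TreeState A (n + 1) → Fin A → unitInterval)
    (π : PolicyFamily (TreeState A (n + 1)) (Fin A) Θ (n + 1)) (θ : Θ)
    {f : Trajectory (TreeState A (n + 1)) (Fin A) (n + 1) → ENNReal} (hf : Measurable f) :
    ∫⁻ t, f t ∂((treeMDP hH p).episodeKernel π θ) =
      ∫⁻ x, (ENNReal.ofReal (p x.1.2 x.2) * f (snoc x.1.1 (x.1.2, x.2, 1)) +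
        ENNReal.ofReal (1 - p x.1.2 x.2) * f (snoc x.1.1 (x.1.2, x.2, 0)))
        ∂(armKernel π θ) := by
  have hp : Measurable fun x : ((Fin n → Step (TreeState A (n + 1)) (Fin A)) ×
      TreeState A (n + 1)) × Fin A => ((p x.1.2 x.2 : unitInterval) : ℝ) :=
    (Measurable.of_discrete (f := fun y : TreeState A (n + 1) × Fin A =>
      ((p y.1 y.2 : unitInterval) : ℝ))).comp
      (f := fun x : ((Fin n → Step (TreeState A (n + 1)) (Fin A)) × TreeState A (n + 1)) × Fin A =>
        (x.1.2, x.2)) (by fun_prop)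
  have hs : ∀ r : unitInterval, Measurable fun x : ((Fin n → Step (TreeState A (n + 1)) (Fin A)) ×
      TreeState A (n + 1)) × Fin A =>
        f (snoc x.1.1 (x.1.2, x.2, r)) := fun r =>
    hf.comp (measurable_snoc.comp (f := fun x : ((Fin n → Step (TreeState A (n + 1)) (Fin A)) ×
      TreeState A (n + 1)) × Fin A => (x.1.1, (x.1.2, x.2, r))) (by fun_prop))
  rw [TabularMDP.episodeKernel, Kernel.lintegral_map _ measurable_fst _ hf,
    lintegral_prefixKernel_tree hH p π le_rfl θ (f := fun z => f z.1) (hf.comp measurable_fst),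
    prefixKernel_tree_eq hH p (fun _ _ => 0) π θ n le_rfl, armKernel,
    Kernel.lintegral_compProd]
  swap
  · exact (hp.ennreal_ofReal.mul (hs 1)).add ((measurable_const.sub hp).ennreal_ofReal.mul (hs 0))
  refine lintegral_congr_ae ?_
  filter_upwards [ae_prefixKernel_layer hH (fun _ _ => 0) π θ n le_rfl] with x hx
  simp only [hx.1, if_true]

theorem ae_armKernel_rewards (π : PolicyFamily (TreeState A (n + 1)) (Fin A) Θ (n + 1)) (θ : Θ) :
    ∀ᵐ x ∂(armKernel π θ), ∀ j, (x.1.1 j).2.2 = 0 := by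
  refine Kernel.ae_compProd_of_ae_ae ?_ ?_
  · rw [Set.ofPred_forall]
    exact MeasurableSet.iInter fun j =>
      measurableSet_eq_fun (by fun_prop) measurable_const
  · filter_upwards [ae_prefixKernel_layer (Nat.succ_pos n) (fun _ _ => 0) π θ n le_rfl] with x hx
    exact Filter.Eventually.of_forall fun a => hx.2

/-- The probability that an episode ends with the arm `w`. -/
def armProb (π : PolicyFamily (TreeState A (n + 1)) (Fin A) Θ (n + 1)) (w : Fin (n + 1) → Fin A)
    (θ : Θ) : ℝ :=
  (armKernel π θ).real {x | (x.1.2, x.2) = arm w}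

theorem measurableSet_arm (w : Fin (n + 1) → Fin A) :
    MeasurableSet {x : ((Fin n → Step (TreeState A (n + 1)) (Fin A)) × TreeState A (n + 1)) ×
        Fin A |
      (x.1.2, x.2) = arm w} :=
  measurableSet_eq_fun (by fun_prop) measurable_const

@[fun_prop]
theorem measurable_armProb (π : PolicyFamily (TreeState A (n + 1)) (Fin A) Θ (n + 1))
    (w : Fin (n + 1) → Fin A) : Measurable (armProb π w) :=
  ((armKernel π).measurable_coe (measurableSet_arm w)).ennreal_toReal

theorem armProb_nonneg (π : PolicyFamily (TreeState A (n + 1)) (Fin A) Θ (n + 1))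
    (w : Fin (n + 1) → Fin A) (θ : Θ) : 0 ≤ armProb π w θ :=
  measureReal_nonneg

theorem sum_armProb_le_one (π : PolicyFamily (TreeState A (n + 1)) (Fin A) Θ (n + 1)) (θ : Θ) :
    ∑ w, armProb π w θ ≤ 1 := by
  unfold armProb
  rw [← measureReal_biUnion_finset]
  · exact measureReal_le_one
  · intro v _ w _ hvw
    refine Set.disjoint_left.2 fun x hx hx' => hvw (arm_injective ?_)
    exact hx.symm.trans hx'
  · exact fun w _ => measurableSet_arm w

theorem armProb_le_one (π : PolicyFamily (TreeState A (n + 1)) (Fin A) Θ (n + 1))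
    (w : Fin (n + 1) → Fin A) (θ : Θ) : armProb π w θ ≤ 1 :=
  measureReal_le_one

theorem armProb_at (π : PolicyFamily (TreeState A (n + 1)) (Fin A) Θ (n + 1))
    (w : Fin (n + 1) → Fin A) (θ : Θ) : armProb (π.at θ) w () = armProb π w θ := by
  have : armKernel (π.at θ) () = armKernel π θ := by
    refine Measure.ext_of_lintegral _ fun f hf => ?_
    rw [armKernel, armKernel, Kernel.lintegral_compProd _ _ _ hf,
      Kernel.lintegral_compProd _ _ _ hf, prefixKernel_at]
    rfl
  rw [armProb, armProb, this]

/-- The policy that plays the actions `w` whatever happens. -/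
def pathPolicy (w : Fin (n + 1) → Fin A) : Policy (TreeState A (n + 1)) (Fin A) (n + 1) where
  act h := Kernel.const _ (Measure.dirac (w h))
  markov _ := inferInstance

theorem ae_prefixKernel_pathPolicy (hH : 0 < n + 1)
    (p : TreeState A (n + 1) → Fin A → unitInterval) (w : Fin (n + 1) → Fin A) :
    ∀ (m : ℕ) (hm : m ≤ n),
      ∀ᵐ x ∂((treeMDP hH p).prefixKernel (pathPolicy w) m (Nat.le_succ_of_le hm) ()),
        x.2 = pathNode w m (Nat.lt_succ_of_le hm)
  | 0, _ => by
    change ∀ᵐ x ∂(Measure.dirac (Fin.elim0, TreeState.root hH)), _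
    rw [ae_dirac_iff (measurableSet_eq_fun (by fun_prop) measurable_const)]
    exact congrArg (Sigma.mk _) (funext fun j => j.elim0)
  | m + 1, hm => by
    refine ae_prefixKernel_succ _ _ _ _ (measurableSet_eq_fun (by fun_prop) measurable_const) ?_
    filter_upwards [ae_prefixKernel_pathPolicy hH p w m (Nat.le_of_succ_le hm)] with x hx
    change ∀ᵐ a ∂(Measure.dirac (w ⟨m, by omega⟩)), _
    rw [ae_dirac_iff .of_discrete]
    filter_upwards [ae_stepKernel_of_not_leaf hH p ⟨m, by omega⟩ (x.2, w ⟨m, by omega⟩)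
      (by rw [hx]; simp [pathNode, TreeState.layer]; omega)] with y hy
    subst hy
    simp only [appendStep, hx]
    exact child_pathNode w m (by omega)

theorem armProb_pathPolicy (w : Fin (n + 1) → Fin A) : armProb (pathPolicy w) w () = 1 := by
  have : ∀ᵐ x ∂(armKernel (pathPolicy w) ()), (x.1.2, x.2) = arm w := by
    refine Kernel.ae_compProd_of_ae_ae (measurableSet_arm w) ?_
    filter_upwards [ae_prefixKernel_pathPolicy (Nat.succ_pos n) (fun _ _ => 0) w n le_rfl] with x hx
    change ∀ᵐ a ∂(Measure.dirac (w (Fin.last n))), _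
    rw [ae_dirac_iff .of_discrete]
    rw [hx]
    rfl
  rw [armProb, measureReal_def, prob_compl_eq_zero_iff (measurableSet_arm w) |>.1 this,
    ENNReal.toReal_one]

end Tree

/-! ### CVaR and regret in the instance with one distinguished arm -/

/-- A return that is `1` with probability `m ≥ 1 - τ` and `0` otherwise has CVaR
`1 - (1 - m) / τ`, attained at `b = 1`. -/
theorem cvar_bernoulli {τ m : ℝ} (hτ0 : 0 < τ) (hτ1 : τ < 1) (hm : 1 - τ ≤ m) (hm1 : m ≤ 1) :
    cvar τ (ENNReal.ofReal m • Measure.dirac 1 + ENNReal.ofReal (1 - m) • Measure.dirac 0) =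
      1 - (1 - m) / τ := by
  have hint : ∀ b : ℝ, ∫ x, max (b - x) 0 ∂(ENNReal.ofReal m • Measure.dirac (1 : ℝ) +
      ENNReal.ofReal (1 - m) • Measure.dirac 0) = m * max (b - 1) 0 + (1 - m) * max b 0 := by
    intro b
    have hi : ∀ c : ℝ, ∀ q : ℝ, Integrable (fun x : ℝ => max (b - x) 0)
        (ENNReal.ofReal q • Measure.dirac c) := fun c q =>
      (integrable_dirac (by simp)).smul_measure ENNReal.ofReal_ne_top
    rw [integral_add_measure (hi _ _) (hi _ _), integral_smul_measure, integral_smul_measure,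
      integral_dirac, integral_dirac, ENNReal.toReal_ofReal (by linarith),
      ENNReal.toReal_ofReal (by linarith)]
    simp
  unfold cvar
  simp_rw [hint]
  have hle : ∀ b : ℝ, b - τ⁻¹ * (m * max (b - 1) 0 + (1 - m) * max b 0) ≤ 1 - (1 - m) / τ := by
    intro b
    have h1 : (1 - m) / τ ≤ 1 := by rw [div_le_one hτ0]; linarith
    have h2 : 0 ≤ (1 - m) / τ := div_nonneg (by linarith) hτ0.le
    have h3 : 1 ≤ τ⁻¹ := (one_le_inv₀ hτ0).2 hτ1.le
    -- The objective is piecewise affine in `b` with kinks at the two values of the return.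
    rcases le_total b 0 with hb | hb
    · rw [max_eq_right hb, max_eq_right (by linarith)]
      simp only [mul_zero, add_zero, sub_zero]
      linarith
    rcases le_total b 1 with hb' | hb'
    · rw [max_eq_left hb, max_eq_right (by linarith)]
      have : b - τ⁻¹ * (m * 0 + (1 - m) * b) = b * (1 - (1 - m) / τ) := by
        rw [div_eq_inv_mul]; ring
      rw [this]
      nlinarith
    · rw [max_eq_left hb, max_eq_left (by linarith)]
      have : b - τ⁻¹ * (m * (b - 1) + (1 - m) * b) =
          1 - (1 - m) / τ - (τ⁻¹ - 1) * (b - 1) := by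
        rw [div_eq_inv_mul]; ring
      rw [this]
      nlinarith
  refine le_antisymm (ciSup_le hle) ?_
  refine le_trans (le_of_eq ?_) (le_ciSup ⟨_, Set.forall_mem_range.2 hle⟩ 1)
  simp [div_eq_inv_mul]

section Tree

variable {A n : ℕ} {Θ : Type*} [MeasurableSpace Θ]

/-- Success probability `1 - τ` (clipped to the unit interval) at every arm. For `0 < τ < 1` this is
the largest common success probability for which every policy has CVaR `0`. -/
def baseSuccess (A n : ℕ) (τ : ℝ) : TreeState A (n + 1) → Fin A → unitInterval :=
  fun _ _ => Set.projIcc 0 1 zero_le_one (1 - τ)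

open Classical in
/-- Success probability `1 - τ + ε` (clipped to the unit interval) at the arm `w` and `1 - τ` at the
other arms. -/
def armSuccess (τ ε : ℝ) (w : Fin (n + 1) → Fin A) : TreeState A (n + 1) → Fin A → unitInterval :=
  fun s a => Set.projIcc 0 1 zero_le_one (if (s, a) = arm w then 1 - τ + ε else 1 - τ)

theorem coe_baseSuccess {τ : ℝ} (hτ0 : 0 < τ) (hτ1 : τ < 1) (s : TreeState A (n + 1)) (a : Fin A) :
    (baseSuccess A n τ s a : ℝ) = 1 - τ := by
  rw [baseSuccess, Set.projIcc_of_mem zero_le_one (Set.mem_Icc.2 ⟨by linarith, by linarith⟩)]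

open Classical in
theorem coe_armSuccess {τ ε : ℝ} (hτ1 : τ < 1) (hε0 : 0 ≤ ε) (hε : ε < τ)
    (w : Fin (n + 1) → Fin A) (s : TreeState A (n + 1)) (a : Fin A) :
    (armSuccess τ ε w s a : ℝ) = if (s, a) = arm w then 1 - τ + ε else 1 - τ := by
  rw [armSuccess, Set.projIcc_of_mem zero_le_one]
  split_ifs <;> exact Set.mem_Icc.2 ⟨by linarith, by linarith⟩

open Classical in
theorem lintegral_armKernel_ite (π : PolicyFamily (TreeState A (n + 1)) (Fin A) Θ (n + 1))
    (w : Fin (n + 1) → Fin A) (θ : Θ) (c d : ENNReal) :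
    ∫⁻ x, (if (x.1.2, x.2) = arm w then c else d) ∂(armKernel π θ) =
      ENNReal.ofReal (armProb π w θ) * c + ENNReal.ofReal (1 - armProb π w θ) * d := by
  have hS := measurableSet_arm (n := n) w
  have hc : ∫⁻ x in {x | (x.1.2, x.2) = arm w}, (if (x.1.2, x.2) = arm w then c else d)
      ∂(armKernel π θ) = ∫⁻ x in {x | (x.1.2, x.2) = arm w}, c ∂(armKernel π θ) :=
    setLIntegral_congr_fun hS fun x hx => if_pos hx
  have hd : ∫⁻ x in {x | (x.1.2, x.2) = arm w}ᶜ, (if (x.1.2, x.2) = arm w then c else d)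
      ∂(armKernel π θ) = ∫⁻ x in {x | (x.1.2, x.2) = arm w}ᶜ, d ∂(armKernel π θ) :=
    setLIntegral_congr_fun hS.compl fun x hx => if_neg hx
  rw [← lintegral_add_compl _ hS, hc, hd,
    setLIntegral_const, setLIntegral_const, armProb, ← probReal_compl_eq_one_sub hS,
    measureReal_def, measureReal_def, ENNReal.ofReal_toReal (measure_ne_top _ _),
    ENNReal.ofReal_toReal (measure_ne_top _ _), mul_comm c, mul_comm d]

theorem trajectoryReturn_snoc (t : Fin n → Step (TreeState A (n + 1)) (Fin A))
    (ht : ∀ j, (t j).2.2 = 0) (s : TreeState A (n + 1)) (a : Fin A) (r : unitInterval) :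
    trajectoryReturn (snoc t (s, a, r)) = r := by
  simp [trajectoryReturn, Fin.sum_univ_castSucc, snoc, ht]

theorem measurable_trajectoryReturn :
    Measurable (trajectoryReturn : Trajectory (TreeState A (n + 1)) (Fin A) (n + 1) → ℝ) := by
  unfold trajectoryReturn
  fun_prop

theorem returnLaw_armSuccess (hH : 0 < n + 1) {τ ε : ℝ} (hτ1 : τ < 1)
    (hε0 : 0 ≤ ε) (hε : ε < τ) (w : Fin (n + 1) → Fin A)
    (π : Policy (TreeState A (n + 1)) (Fin A) (n + 1)) :
    (treeMDP hH (armSuccess τ ε w)).returnLaw π =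
      ENNReal.ofReal (1 - τ + ε * armProb π w ()) • Measure.dirac 1 +
        ENNReal.ofReal (1 - (1 - τ + ε * armProb π w ())) • Measure.dirac 0 := by
  classical
  refine Measure.ext_of_lintegral _ fun f hf => ?_
  have hq0 := armProb_nonneg π w ()
  have hq1 := armProb_le_one π w ()
  rw [TabularMDP.returnLaw, lintegral_map hf measurable_trajectoryReturn,
    lintegral_episodeKernel_tree hH _ π () (f := fun t => f (trajectoryReturn t))
      (hf.comp measurable_trajectoryReturn)]
  have hae : ∀ᵐ x ∂(armKernel π ()),
      ENNReal.ofReal (armSuccess τ ε w x.1.2 x.2) *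
          f (trajectoryReturn (snoc x.1.1 (x.1.2, x.2, 1))) +
        ENNReal.ofReal (1 - armSuccess τ ε w x.1.2 x.2) *
          f (trajectoryReturn (snoc x.1.1 (x.1.2, x.2, 0))) =
      if (x.1.2, x.2) = arm w then
        ENNReal.ofReal (1 - τ + ε) * f 1 + ENNReal.ofReal (τ - ε) * f 0
      else ENNReal.ofReal (1 - τ) * f 1 + ENNReal.ofReal τ * f 0 := by
    filter_upwards [ae_armKernel_rewards π ()] with x hx
    rw [trajectoryReturn_snoc _ hx, trajectoryReturn_snoc _ hx, coe_armSuccess hτ1 hε0 hε]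
    split_ifs
    · congr 3
      ring
    · congr 3
      ring
  rw [lintegral_congr_ae hae, lintegral_armKernel_ite, lintegral_add_measure,
    lintegral_smul_measure, lintegral_smul_measure, lintegral_dirac' _ hf, lintegral_dirac' _ hf,
    smul_eq_mul, smul_eq_mul]
  generalize armProb π w () = q at *
  have e1 : 1 - τ + ε * q = q * (1 - τ + ε) + (1 - q) * (1 - τ) := by ring
  have e2 : 1 - (1 - τ + ε * q) = q * (τ - ε) + (1 - q) * τ := by ring
  rw [e2, e1, ENNReal.ofReal_add (mul_nonneg hq0 (by linarith))
    (mul_nonneg (by linarith) (by linarith)), ENNReal.ofReal_add (mul_nonneg hq0 (by linarith))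
    (mul_nonneg (by linarith) (by linarith)), ENNReal.ofReal_mul hq0, ENNReal.ofReal_mul hq0,
    ENNReal.ofReal_mul (by linarith : 0 ≤ 1 - q), ENNReal.ofReal_mul (by linarith : 0 ≤ 1 - q)]
  ring

theorem normalized_armSuccess (hH : 0 < n + 1) {τ ε : ℝ} (hτ1 : τ < 1)
    (hε0 : 0 ≤ ε) (hε : ε < τ) (w : Fin (n + 1) → Fin A) :
    (treeMDP hH (armSuccess τ ε w)).Normalized := by
  intro π
  rw [returnLaw_armSuccess hH hτ1 hε0 hε w π, ae_add_measure_iff]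
  constructor
  · exact Measure.ae_smul_measure
      ((ae_dirac_iff (p := fun x : ℝ => x ∈ Set.Icc (0 : ℝ) 1) measurableSet_Icc).2 (by simp)) _
  · exact Measure.ae_smul_measure
      ((ae_dirac_iff (p := fun x : ℝ => x ∈ Set.Icc (0 : ℝ) 1) measurableSet_Icc).2 (by simp)) _

theorem cvar_armSuccess (hH : 0 < n + 1) {τ ε : ℝ} (hτ1 : τ < 1)
    (hε0 : 0 ≤ ε) (hε : ε < τ) (w : Fin (n + 1) → Fin A)
    (π : Policy (TreeState A (n + 1)) (Fin A) (n + 1)) :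
    cvar τ ((treeMDP hH (armSuccess τ ε w)).returnLaw π) = ε / τ * armProb π w () := by
  have hτ0 : 0 < τ := hε0.trans_lt hε
  have hq0 := armProb_nonneg π w ()
  have hq1 := armProb_le_one π w ()
  rw [returnLaw_armSuccess hH hτ1 hε0 hε w π, cvar_bernoulli hτ0 hτ1 (by nlinarith) (by nlinarith)]
  field_simp
  ring

theorem optCVaR_armSuccess (hH : 0 < n + 1) {τ ε : ℝ} (hτ1 : τ < 1)
    (hε0 : 0 ≤ ε) (hε : ε < τ) (w : Fin (n + 1) → Fin A) :
    (treeMDP hH (armSuccess τ ε w)).optCVaR τ = ε / τ := by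
  have hτ0 : 0 < τ := hε0.trans_lt hε
  have hle : ∀ π, cvar τ ((treeMDP hH (armSuccess τ ε w)).returnLaw π) ≤ ε / τ := fun π => by
    rw [cvar_armSuccess hH hτ1 hε0 hε]
    exact mul_le_of_le_one_right (by positivity) (armProb_le_one _ _ _)
  have : Nonempty (Policy (TreeState A (n + 1)) (Fin A) (n + 1)) := ⟨pathPolicy w⟩
  refine le_antisymm (ciSup_le hle) ?_
  refine le_trans (le_of_eq ?_) (le_ciSup ⟨_, Set.forall_mem_range.2 hle⟩ (pathPolicy w))
  rw [cvar_armSuccess hH hτ1 hε0 hε, armProb_pathPolicy, mul_one]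

end Tree

section Learning

variable {A n K : ℕ} {Ω : Type*} [MeasurableSpace Ω]

/-- The conditional expectation, given the past, of the number of times the arm `w` is played in
the first `k` episodes: the sum of the probabilities of playing it. -/
def armCount (alg : Algorithm (TreeState A (n + 1)) (Fin A) Ω (n + 1) K)
    (w : Fin (n + 1) → Fin A) (k : ℕ) (hk : k ≤ K)
    (x : Ω × (Fin k → Trajectory (TreeState A (n + 1)) (Fin A) (n + 1))) : ℝ :=
  ∑ j : Fin k, armProb (alg (j.castLE hk)) w (x.1, fun i => x.2 (i.castLE j.isLt.le))

@[fun_prop]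
theorem measurable_armCount (alg : Algorithm (TreeState A (n + 1)) (Fin A) Ω (n + 1) K)
    (w : Fin (n + 1) → Fin A) (k : ℕ) (hk : k ≤ K) : Measurable (armCount alg w k hk) := by
  unfold armCount
  refine Finset.measurable_sum _ fun j _ => (measurable_armProb _ w).comp ?_
  fun_prop

theorem armCount_nonneg (alg : Algorithm (TreeState A (n + 1)) (Fin A) Ω (n + 1) K)
    (w : Fin (n + 1) → Fin A) (k : ℕ) (hk : k ≤ K)
    (x : Ω × (Fin k → Trajectory (TreeState A (n + 1)) (Fin A) (n + 1))) :
    0 ≤ armCount alg w k hk x :=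
  Finset.sum_nonneg fun _ _ => armProb_nonneg _ _ _

theorem sum_armCount_le (alg : Algorithm (TreeState A (n + 1)) (Fin A) Ω (n + 1) K)
    (k : ℕ) (hk : k ≤ K)
    (x : Ω × (Fin k → Trajectory (TreeState A (n + 1)) (Fin A) (n + 1))) :
    ∑ w, armCount alg w k hk x ≤ k := by
  unfold armCount
  rw [Finset.sum_comm]
  refine (Finset.sum_le_sum fun j _ => sum_armProb_le_one _ _).trans ?_
  simp

theorem armCount_le (alg : Algorithm (TreeState A (n + 1)) (Fin A) Ω (n + 1) K)
    (w : Fin (n + 1) → Fin A) (k : ℕ) (hk : k ≤ K)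
    (x : Ω × (Fin k → Trajectory (TreeState A (n + 1)) (Fin A) (n + 1))) :
    armCount alg w k hk x ≤ k :=
  (Finset.single_le_sum (f := fun w => armCount alg w k hk x)
    (fun w _ => armCount_nonneg alg w k hk x) (Finset.mem_univ w)).trans
    (sum_armCount_le alg k hk x)

theorem armCount_succ (alg : Algorithm (TreeState A (n + 1)) (Fin A) Ω (n + 1) K)
    (w : Fin (n + 1) → Fin A) (k : ℕ) (hk : k + 1 ≤ K)
    (x : Ω × (Fin k → Trajectory (TreeState A (n + 1)) (Fin A) (n + 1)))
    (t : Trajectory (TreeState A (n + 1)) (Fin A) (n + 1)) :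
    armCount alg w (k + 1) hk (x.1, snoc x.2 t) =
      armCount alg w k (Nat.le_of_succ_le hk) x + armProb (alg ⟨k, hk⟩) w x := by
  have hs : ∀ i : Fin k, snoc x.2 t i.castSucc = x.2 i := fun i => by simp [snoc]
  unfold armCount
  rw [Fin.sum_univ_castSucc]
  congr 1
  · refine Finset.sum_congr rfl fun j _ => ?_
    congr 2
    funext i
    exact hs (i.castLE j.isLt.le)
  · refine congrArg (armProb (alg ⟨k, hk⟩) w) (Prod.ext rfl ?_)
    funext i
    exact hs i

theorem integrable_armCount (alg : Algorithm (TreeState A (n + 1)) (Fin A) Ω (n + 1) K)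
    (w : Fin (n + 1) → Fin A) (k : ℕ) (hk : k ≤ K)
    (P : Measure (Ω × (Fin k → Trajectory (TreeState A (n + 1)) (Fin A) (n + 1))))
    [IsFiniteMeasure P] : Integrable (armCount alg w k hk) P :=
  Integrable.of_bound (measurable_armCount alg w k hk).aestronglyMeasurable k
    (Filter.Eventually.of_forall fun x => by
      rw [Real.norm_of_nonneg (armCount_nonneg alg w k hk x)]
      exact armCount_le alg w k hk x)

theorem expectedRegret_armSuccess (hH : 0 < n + 1) {τ ε : ℝ} (hτ1 : τ < 1)
    (hε0 : 0 ≤ ε) (hε : ε < τ) (w : Fin (n + 1) → Fin A) (μ : Measure Ω) [IsProbabilityMeasure μ]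
    (alg : Algorithm (TreeState A (n + 1)) (Fin A) Ω (n + 1) K) :
    (treeMDP hH (armSuccess τ ε w)).expectedRegret τ μ alg =
      ε / τ * (K - ∫ x, armCount alg w K le_rfl x
        ∂((treeMDP hH (armSuccess τ ε w)).learningLaw μ alg K le_rfl)) := by
  have hreg : ∀ x : Ω × (Fin K → Trajectory (TreeState A (n + 1)) (Fin A) (n + 1)),
      (treeMDP hH (armSuccess τ ε w)).regret τ alg x.1 x.2 =
        ε / τ * (K - armCount alg w K le_rfl x) := by
    intro x
    have : (K : ℝ) = ∑ k : Fin K, (1 : ℝ) := by simp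
    rw [TabularMDP.regret, armCount, this, ← Finset.sum_sub_distrib, Finset.mul_sum]
    refine Finset.sum_congr rfl fun k _ => ?_
    rw [optCVaR_armSuccess hH hτ1 hε0 hε, cvar_armSuccess hH hτ1 hε0 hε, Algorithm.played,
      armProb_at, mul_sub, mul_one]
    rfl
  rw [TabularMDP.expectedRegret]
  simp_rw [hreg]
  rw [integral_const_mul, integral_sub (integrable_const _) (integrable_armCount _ _ _ _ _)]
  simp

end Learning

/-! ### Likelihood ratios and the change of measure -/

section Likelihood

variable {A n K : ℕ} {Θ Ω : Type*} [MeasurableSpace Θ] [MeasurableSpace Ω]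

open Classical in
/-- The likelihood ratio, between the instance with distinguished arm `w` and the base instance, of
one episode. It is read off from the last step, whose reward is `1` or `0` almost surely. -/
def likelihood (τ ε : ℝ) (w : Fin (n + 1) → Fin A)
    (t : Trajectory (TreeState A (n + 1)) (Fin A) (n + 1)) : ℝ :=
  if ((t (Fin.last n)).1, (t (Fin.last n)).2.1) = arm w then
    if (t (Fin.last n)).2.2 = 1 then (1 - τ + ε) / (1 - τ) else (τ - ε) / τ
  else 1

@[fun_prop]
theorem measurable_likelihood (τ ε : ℝ) (w : Fin (n + 1) → Fin A) :
    Measurable (likelihood τ ε w) := by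
  unfold likelihood
  refine Measurable.ite ?_ (Measurable.ite ?_ measurable_const measurable_const) measurable_const
  · exact measurableSet_eq_fun (by fun_prop) measurable_const
  · exact measurableSet_eq_fun (by fun_prop) measurable_const

theorem likelihood_pos {τ ε : ℝ} (hτ1 : τ < 1) (hε0 : 0 ≤ ε) (hε : ε < τ)
    (w : Fin (n + 1) → Fin A) (t : Trajectory (TreeState A (n + 1)) (Fin A) (n + 1)) :
    0 < likelihood τ ε w t := by
  have hτ0 : 0 < τ := hε0.trans_lt hε
  unfold likelihood
  split_ifs
  · exact div_pos (by linarith) (by linarith)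
  · exact div_pos (by linarith) (by linarith)
  · exact one_pos

open Classical in
theorem likelihood_snoc (τ ε : ℝ) (w : Fin (n + 1) → Fin A)
    (t : Fin n → Step (TreeState A (n + 1)) (Fin A)) (s : TreeState A (n + 1)) (a : Fin A)
    (r : unitInterval) :
    likelihood τ ε w (snoc t (s, a, r)) =
      if (s, a) = arm w then if r = 1 then (1 - τ + ε) / (1 - τ) else (τ - ε) / τ else 1 := by
  simp [likelihood, snoc]

theorem lintegral_episodeKernel_armSuccess (hH : 0 < n + 1) {τ ε : ℝ} (hτ1 : τ < 1)
    (hε0 : 0 ≤ ε) (hε : ε < τ) (w : Fin (n + 1) → Fin A)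
    (π : PolicyFamily (TreeState A (n + 1)) (Fin A) Θ (n + 1)) (θ : Θ)
    {f : Trajectory (TreeState A (n + 1)) (Fin A) (n + 1) → ENNReal} (hf : Measurable f) :
    ∫⁻ t, f t ∂((treeMDP hH (armSuccess τ ε w)).episodeKernel π θ) =
      ∫⁻ t, ENNReal.ofReal (likelihood τ ε w t) * f t
        ∂((treeMDP hH (baseSuccess A n τ)).episodeKernel π θ) := by
  classical
  have hτ0 : 0 < τ := hε0.trans_lt hε
  rw [lintegral_episodeKernel_tree hH _ π θ hf, lintegral_episodeKernel_tree hH _ π θ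
    (f := fun t => ENNReal.ofReal (likelihood τ ε w t) * f t) (by fun_prop)]
  refine lintegral_congr fun x => ?_
  rw [likelihood_snoc, likelihood_snoc, coe_armSuccess hτ1 hε0 hε, coe_baseSuccess hτ0 hτ1,
    ← mul_assoc, ← mul_assoc, ← ENNReal.ofReal_mul (by linarith),
    ← ENNReal.ofReal_mul (by linarith)]
  have h1 : (1 - τ) ≠ 0 := by linarith
  have h01 : (0 : unitInterval) ≠ 1 := zero_ne_one
  simp only [if_true, h01, if_false]
  split_ifs
  · congr 3
    · field_simp
    · field_simp
      ring
  · simp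

/-- The mean under the base instance of the inverse likelihood ratio. The excess over `1` is the
probability of playing the distinguished arm times a `χ²`-divergence of Bernoulli laws. -/
theorem lintegral_inv_likelihood (hH : 0 < n + 1) {τ ε : ℝ} (hτ1 : τ < 1)
    (hε0 : 0 ≤ ε) (hε : ε < τ) (w : Fin (n + 1) → Fin A)
    (π : PolicyFamily (TreeState A (n + 1)) (Fin A) Θ (n + 1)) (θ : Θ) :
    ∫⁻ t, ENNReal.ofReal (likelihood τ ε w t)⁻¹
        ∂((treeMDP hH (baseSuccess A n τ)).episodeKernel π θ) =
      ENNReal.ofReal (1 + ε ^ 2 / ((1 - τ + ε) * (τ - ε)) * armProb π w θ) := by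
  classical
  have hτ0 : 0 < τ := hε0.trans_lt hε
  have hχ : 0 ≤ ε ^ 2 / ((1 - τ + ε) * (τ - ε)) :=
    div_nonneg (sq_nonneg _) (mul_nonneg (by linarith) (by linarith))
  have hq0 := armProb_nonneg π w θ
  have hq1 := armProb_le_one π w θ
  rw [lintegral_episodeKernel_tree hH _ π θ (by fun_prop)]
  have : ∀ x : ((Fin n → Step (TreeState A (n + 1)) (Fin A)) × TreeState A (n + 1)) × Fin A,
      ENNReal.ofReal (baseSuccess A n τ x.1.2 x.2) *
          ENNReal.ofReal (likelihood τ ε w (snoc x.1.1 (x.1.2, x.2, 1)))⁻¹ +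
        ENNReal.ofReal (1 - baseSuccess A n τ x.1.2 x.2) *
          ENNReal.ofReal (likelihood τ ε w (snoc x.1.1 (x.1.2, x.2, 0)))⁻¹ =
      if (x.1.2, x.2) = arm w then ENNReal.ofReal (1 + ε ^ 2 / ((1 - τ + ε) * (τ - ε)))
      else ENNReal.ofReal 1 := by
    intro x
    have hp := fun t => (inv_pos.2 (likelihood_pos hτ1 hε0 hε w t)).le
    rw [coe_baseSuccess hτ0 hτ1, ← ENNReal.ofReal_mul (by linarith),
      ← ENNReal.ofReal_mul (by linarith),
      ← ENNReal.ofReal_add (mul_nonneg (by linarith) (hp _)) (mul_nonneg (by linarith) (hp _)),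
      ← apply_ite ENNReal.ofReal, likelihood_snoc, likelihood_snoc]
    have h01 : (0 : unitInterval) ≠ 1 := zero_ne_one
    simp only [if_true, h01, if_false]
    congr 1
    split_ifs
    · have h2 : 1 - τ + ε ≠ 0 := by linarith
      have h3 : τ - ε ≠ 0 := by linarith
      rw [inv_div, inv_div]
      field_simp
      ring
    · simp
  simp_rw [this]
  rw [lintegral_armKernel_ite, ← ENNReal.ofReal_mul hq0, ← ENNReal.ofReal_mul (by linarith),
    ← ENNReal.ofReal_add (mul_nonneg hq0 (by linarith)) (by linarith)]
  congr 1
  ring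

/-- The law of the data in the instance with distinguished arm `w` has, with respect to the law in
the base instance, the product of the likelihood ratios of the episodes as its density. -/
theorem lintegral_learningLaw_armSuccess (hH : 0 < n + 1) {τ ε : ℝ} (hτ1 : τ < 1)
    (hε0 : 0 ≤ ε) (hε : ε < τ) (w : Fin (n + 1) → Fin A) (μ : Measure Ω) [IsProbabilityMeasure μ]
    (alg : Algorithm (TreeState A (n + 1)) (Fin A) Ω (n + 1) K) :
    ∀ (k : ℕ) (hk : k ≤ K)
      (f : Ω × (Fin k → Trajectory (TreeState A (n + 1)) (Fin A) (n + 1)) → ENNReal),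
      Measurable f →
      ∫⁻ x, f x ∂((treeMDP hH (armSuccess τ ε w)).learningLaw μ alg k hk) =
        ∫⁻ x, ENNReal.ofReal (∏ j, likelihood τ ε w (x.2 j)) * f x
          ∂((treeMDP hH (baseSuccess A n τ)).learningLaw μ alg k hk)
  | 0, _, f, _ => by simp [TabularMDP.learningLaw]
  | k + 1, hk, f, hf => by
    have hL : Measurable fun x : Ω × (Fin k → Trajectory (TreeState A (n + 1)) (Fin A) (n + 1)) =>
        ∏ j, likelihood τ ε w (x.2 j) := by fun_prop
    have hg : Measurable fun z : (Ω × (Fin k → Trajectory (TreeState A (n + 1)) (Fin A) (n + 1))) ×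
        Trajectory (TreeState A (n + 1)) (Fin A) (n + 1) => f (z.1.1, snoc z.1.2 z.2) :=
      hf.comp measurable_snocTrajectory
    rw [lintegral_learningLaw_succ _ _ _ _ hf, lintegral_learningLaw_succ _ _ _ _ (by fun_prop)]
    have h1 : ∀ x : Ω × (Fin k → Trajectory (TreeState A (n + 1)) (Fin A) (n + 1)),
        ∫⁻ t, f (x.1, snoc x.2 t) ∂((treeMDP hH (armSuccess τ ε w)).episodeKernel (alg ⟨k, hk⟩) x) =
        ∫⁻ t, ENNReal.ofReal (likelihood τ ε w t) * f (x.1, snoc x.2 t)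
          ∂((treeMDP hH (baseSuccess A n τ)).episodeKernel (alg ⟨k, hk⟩) x) := fun x =>
      lintegral_episodeKernel_armSuccess hH hτ1 hε0 hε w _ x (hg.comp measurable_prodMk_left)
    simp_rw [h1]
    rw [lintegral_learningLaw_armSuccess hH hτ1 hε0 hε w μ alg k (Nat.le_of_succ_le hk)]
    swap
    · exact Measurable.lintegral_kernel_prod_right'
        (κ := (treeMDP hH (baseSuccess A n τ)).episodeKernel (alg ⟨k, hk⟩))
        (f := fun z => ENNReal.ofReal (likelihood τ ε w z.2) * f (z.1.1, snoc z.1.2 z.2))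
        (((measurable_likelihood τ ε w).comp measurable_snd).ennreal_ofReal.mul hg)
    refine lintegral_congr fun x => ?_
    rw [← lintegral_const_mul]
    swap
    · exact ((measurable_likelihood τ ε w).ennreal_ofReal).mul (hg.comp measurable_prodMk_left)
    refine lintegral_congr fun t => ?_
    rw [Fin.prod_univ_castSucc, ENNReal.ofReal_mul
      (Finset.prod_nonneg fun j _ => (likelihood_pos hτ1 hε0 hε w _).le)]
    simp [snoc, mul_assoc]

/-- Summed over the episodes, `lintegral_inv_likelihood` says that the inverse likelihood ratios
and their conditional means have the same expectation. -/
theorem lintegral_sum_inv_likelihood (hH : 0 < n + 1) {τ ε : ℝ} (hτ1 : τ < 1)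
    (hε0 : 0 ≤ ε) (hε : ε < τ) (w : Fin (n + 1) → Fin A) (μ : Measure Ω) [IsProbabilityMeasure μ]
    (alg : Algorithm (TreeState A (n + 1)) (Fin A) Ω (n + 1) K) :
    ∀ (k : ℕ) (hk : k ≤ K),
      ∫⁻ x, ENNReal.ofReal (∑ j, (likelihood τ ε w (x.2 j))⁻¹)
          ∂((treeMDP hH (baseSuccess A n τ)).learningLaw μ alg k hk) =
        ∫⁻ x, ENNReal.ofReal (k + ε ^ 2 / ((1 - τ + ε) * (τ - ε)) * armCount alg w k hk x)
          ∂((treeMDP hH (baseSuccess A n τ)).learningLaw μ alg k hk)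
  | 0, _ => by simp [armCount]
  | k + 1, hk => by
    have hχ : 0 ≤ ε ^ 2 / ((1 - τ + ε) * (τ - ε)) :=
      div_nonneg (sq_nonneg _) (mul_nonneg (by linarith) (by linarith))
    rw [lintegral_learningLaw_succ _ _ _ _ (by fun_prop),
      lintegral_learningLaw_succ _ _ _ _ (by fun_prop)]
    have h1 : ∀ x : Ω × (Fin k → Trajectory (TreeState A (n + 1)) (Fin A) (n + 1)),
        ∫⁻ t, ENNReal.ofReal (∑ j, (likelihood τ ε w (snoc x.2 t j))⁻¹)
          ∂((treeMDP hH (baseSuccess A n τ)).episodeKernel (alg ⟨k, hk⟩) x) =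
        ENNReal.ofReal (∑ j, (likelihood τ ε w (x.2 j))⁻¹) +
          ENNReal.ofReal (1 + ε ^ 2 / ((1 - τ + ε) * (τ - ε)) * armProb (alg ⟨k, hk⟩) w x) := by
      intro x
      rw [← lintegral_inv_likelihood hH hτ1 hε0 hε w _ x]
      have h2 : ∀ t, ENNReal.ofReal (∑ j, (likelihood τ ε w (snoc x.2 t j))⁻¹) =
          ENNReal.ofReal (∑ j, (likelihood τ ε w (x.2 j))⁻¹) +
            ENNReal.ofReal (likelihood τ ε w t)⁻¹ := by
        intro t
        have hp := fun t => (inv_pos.2 (likelihood_pos hτ1 hε0 hε w t)).le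
        rw [← ENNReal.ofReal_add (Finset.sum_nonneg fun j _ => hp _) (hp _),
          Fin.sum_univ_castSucc]
        simp [snoc]
      simp_rw [h2]
      rw [lintegral_add_left measurable_const]
      simp
    have h3 : ∀ x : Ω × (Fin k → Trajectory (TreeState A (n + 1)) (Fin A) (n + 1)),
        ∫⁻ t, ENNReal.ofReal (((k + 1 : ℕ) : ℝ) + ε ^ 2 / ((1 - τ + ε) * (τ - ε)) *
            armCount alg w (k + 1) hk (x.1, snoc x.2 t))
          ∂((treeMDP hH (baseSuccess A n τ)).episodeKernel (alg ⟨k, hk⟩) x) =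
        ENNReal.ofReal (k + ε ^ 2 / ((1 - τ + ε) * (τ - ε)) *
            armCount alg w k (Nat.le_of_succ_le hk) x) +
          ENNReal.ofReal (1 + ε ^ 2 / ((1 - τ + ε) * (τ - ε)) * armProb (alg ⟨k, hk⟩) w x) := by
      intro x
      have hc := armCount_nonneg alg w k (Nat.le_of_succ_le hk) x
      have hq := armProb_nonneg (alg ⟨k, hk⟩) w x
      simp_rw [armCount_succ]
      rw [lintegral_const, measure_univ, mul_one, ← ENNReal.ofReal_add (by positivity)
        (by positivity)]
      congr 1
      push_cast
      ring
    simp_rw [h1, h3]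
    rw [lintegral_add_left (by fun_prop), lintegral_add_left (by fun_prop),
      lintegral_sum_inv_likelihood hH hτ1 hε0 hε w μ alg k (Nat.le_of_succ_le hk)]

/-- A total variation bound in terms of logarithms, pointwise: with `u = √L`,
`|u ^ 2 - 1| = |u - 1| * (u + 1)`, where `(u - 1) ^ 2 ≤ L - 1 - log L` and
`(u + 1) ^ 2 ≤ 2 * (L + 1)`. -/
theorem abs_sub_one_le_log {L : ℝ} (hL : 0 < L) :
    |L - 1| ≤ 5 * (L - 1 - Real.log L) + (L + 1) / 10 := by
  obtain ⟨u, hu, rfl⟩ : ∃ u : ℝ, 0 < u ∧ L = u ^ 2 :=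
    ⟨√L, Real.sqrt_pos.2 hL, (Real.sq_sqrt hL.le).symm⟩
  have hlog : Real.log (u ^ 2) ≤ 2 * (u - 1) := by
    rw [Real.log_pow]
    push_cast
    linarith [Real.log_le_sub_one_of_pos hu]
  rw [abs_le]
  constructor <;>
    nlinarith [sq_nonneg (10 * (u - 1) - (u + 1)), sq_nonneg (10 * (u - 1) + (u + 1)),
      sq_nonneg (u - 1)]

theorem abs_prod_sub_one_le {k : ℕ} {l : Fin k → ℝ} (hl : ∀ j, 0 < l j) :
    |∏ j, l j - 1| ≤ 5 * (∏ j, l j - 1 + (∑ j, (l j)⁻¹ - k)) + (∏ j, l j + 1) / 10 := by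
  have hlog : -Real.log (∏ j, l j) ≤ ∑ j, (l j)⁻¹ - k := by
    have hk : (k : ℝ) = ∑ j : Fin k, (1 : ℝ) := by simp
    rw [Real.log_prod fun j _ => (hl j).ne', ← Finset.sum_neg_distrib, hk,
      ← Finset.sum_sub_distrib]
    refine Finset.sum_le_sum fun j _ => ?_
    rw [← Real.log_inv]
    exact Real.log_le_sub_one_of_pos (inv_pos.2 (hl j))
  have hpos : 0 < ∏ j, l j := Finset.prod_pos fun j _ => hl j
  linarith [abs_sub_one_le_log hpos]

/-- Making the arm `w` the distinguished one raises the expected number of times it is played by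
little, if it is rarely played in the base instance. -/
theorem integral_armCount_armSuccess_le (hH : 0 < n + 1) {τ ε : ℝ} (hτ1 : τ < 1)
    (hε0 : 0 ≤ ε) (hε : ε < τ) (w : Fin (n + 1) → Fin A) (μ : Measure Ω) [IsProbabilityMeasure μ]
    (alg : Algorithm (TreeState A (n + 1)) (Fin A) Ω (n + 1) K) :
    ∫ x, armCount alg w K le_rfl x
        ∂((treeMDP hH (armSuccess τ ε w)).learningLaw μ alg K le_rfl) ≤
      (1 + 5 * K * (ε ^ 2 / ((1 - τ + ε) * (τ - ε)))) * ∫ x, armCount alg w K le_rfl x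
        ∂((treeMDP hH (baseSuccess A n τ)).learningLaw μ alg K le_rfl) + K / 5 := by
  set P := (treeMDP hH (baseSuccess A n τ)).learningLaw μ alg K le_rfl with hP
  set Q := (treeMDP hH (armSuccess τ ε w)).learningLaw μ alg K le_rfl with hQ
  set χ := ε ^ 2 / ((1 - τ + ε) * (τ - ε)) with hχdef
  have hχ : 0 ≤ χ := div_nonneg (sq_nonneg _) (mul_nonneg (by linarith) (by linarith))
  let L : Ω × (Fin K → Trajectory (TreeState A (n + 1)) (Fin A) (n + 1)) → ℝ :=
    fun x => ∏ j, likelihood τ ε w (x.2 j)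
  let V : Ω × (Fin K → Trajectory (TreeState A (n + 1)) (Fin A) (n + 1)) → ℝ :=
    fun x => ∑ j, (likelihood τ ε w (x.2 j))⁻¹
  have hLm : Measurable L := by fun_prop
  have hVm : Measurable V := by fun_prop
  have hL0 : ∀ x, 0 ≤ L x := fun x =>
    Finset.prod_nonneg fun j _ => (likelihood_pos hτ1 hε0 hε w _).le
  have hV0 : ∀ x, 0 ≤ V x := fun x =>
    Finset.sum_nonneg fun j _ => (inv_pos.2 (likelihood_pos hτ1 hε0 hε w _)).le
  have hF0 := armCount_nonneg alg w K le_rfl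
  have hFK := armCount_le alg w K le_rfl
  have hFm := measurable_armCount alg w K le_rfl
  have hFi : Integrable (armCount alg w K le_rfl) P := integrable_armCount alg w K le_rfl P
  -- `L` has mean `1` because the law in the instance with arm `w` is a probability measure.
  have hLl : ∫⁻ x, ENNReal.ofReal (L x) ∂P = 1 := by
    have := lintegral_learningLaw_armSuccess hH hτ1 hε0 hε w μ alg K le_rfl 1 measurable_one
    simp only [Pi.one_apply, lintegral_one, measure_univ, mul_one] at this
    exact this.symm
  have hVl := lintegral_sum_inv_likelihood hH hτ1 hε0 hε w μ alg K le_rfl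
  have hGi : Integrable (fun x => K + χ * armCount alg w K le_rfl x) P :=
    (integrable_const _).add (hFi.const_mul _)
  have hLi : Integrable L P := by
    rw [← lintegral_ofReal_ne_top_iff_integrable hLm.aestronglyMeasurable
      (Filter.Eventually.of_forall hL0), hLl]
    exact ENNReal.one_ne_top
  have hVi : Integrable V P := by
    rw [← lintegral_ofReal_ne_top_iff_integrable hVm.aestronglyMeasurable
      (Filter.Eventually.of_forall hV0)]
    refine (hVl.trans_ne ?_)
    exact (lintegral_ofReal_ne_top_iff_integrable hGi.aestronglyMeasurable
      (Filter.Eventually.of_forall fun x => by have := hF0 x; positivity)).2 hGi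
  have hLint : ∫ x, L x ∂P = 1 := by
    rw [integral_eq_lintegral_of_nonneg_ae (Filter.Eventually.of_forall hL0)
      hLm.aestronglyMeasurable, hLl, ENNReal.toReal_one]
  have hVint : ∫ x, V x ∂P = K + χ * ∫ x, armCount alg w K le_rfl x ∂P := by
    have h1 : ∫ x, (K + χ * armCount alg w K le_rfl x) ∂P =
        K + χ * ∫ x, armCount alg w K le_rfl x ∂P := by
      rw [integral_add (integrable_const _) (hFi.const_mul _), integral_const_mul]
      simp
    rw [← h1, integral_eq_lintegral_of_nonneg_ae (Filter.Eventually.of_forall hV0)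
      hVm.aestronglyMeasurable, integral_eq_lintegral_of_nonneg_ae
      (Filter.Eventually.of_forall fun x => by have := hF0 x; positivity)
      hGi.aestronglyMeasurable]
    exact congrArg ENNReal.toReal hVl
  have hQint : ∫ x, armCount alg w K le_rfl x ∂Q = ∫ x, L x * armCount alg w K le_rfl x ∂P := by
    rw [integral_eq_lintegral_of_nonneg_ae (Filter.Eventually.of_forall hF0)
      hFm.aestronglyMeasurable, integral_eq_lintegral_of_nonneg_ae
      (Filter.Eventually.of_forall fun x => mul_nonneg (hL0 x) (hF0 x))
      (hLm.mul hFm).aestronglyMeasurable, hQ,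
      lintegral_learningLaw_armSuccess hH hτ1 hε0 hε w μ alg K le_rfl _ hFm.ennreal_ofReal]
    congr 1
    refine lintegral_congr fun x => ?_
    rw [ENNReal.ofReal_mul (hL0 x)]
  have hpt : ∀ x, L x * armCount alg w K le_rfl x ≤ armCount alg w K le_rfl x +
      K * (5 * (L x - 1 + (V x - K)) + (L x + 1) / 10) := by
    intro x
    have h1 : |L x - 1| ≤ 5 * (L x - 1 + (V x - K)) + (L x + 1) / 10 :=
      abs_prod_sub_one_le fun j => likelihood_pos hτ1 hε0 hε w (x.2 j)
    have h2 : (L x - 1) * armCount alg w K le_rfl x ≤ |L x - 1| * K :=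
      mul_le_mul (le_abs_self _) (hFK x) (hF0 x) (abs_nonneg _)
    have h3 := mul_le_mul_of_nonneg_right h1 (Nat.cast_nonneg (α := ℝ) K)
    linarith
  have hLs : Integrable (fun x => L x - 1) P := hLi.sub (integrable_const _)
  have hVs : Integrable (fun x => V x - K) P := hVi.sub (integrable_const _)
  have hi1 : Integrable (fun x => L x - 1 + (V x - K)) P := hLs.add hVs
  have hi2 : Integrable (fun x => (L x + 1) / 10) P := (hLi.add (integrable_const _)).div_const _
  have hi3 : Integrable (fun x => 5 * (L x - 1 + (V x - K)) + (L x + 1) / 10) P :=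
    (hi1.const_mul 5).add hi2
  have hRi : Integrable (fun x => armCount alg w K le_rfl x +
      K * (5 * (L x - 1 + (V x - K)) + (L x + 1) / 10)) P := hFi.add (hi3.const_mul _)
  have hLFi : Integrable (fun x => L x * armCount alg w K le_rfl x) P := by
    refine (hLi.mul_const (K : ℝ)).mono' (hLm.mul hFm).aestronglyMeasurable
      (Filter.Eventually.of_forall fun x => ?_)
    rw [Real.norm_of_nonneg (mul_nonneg (hL0 x) (hF0 x))]
    exact mul_le_mul_of_nonneg_left (hFK x) (hL0 x)
  rw [hQint]
  refine (integral_mono hLFi hRi hpt).trans (le_of_eq ?_)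
  rw [integral_add hFi (hi3.const_mul _), integral_const_mul, integral_add (hi1.const_mul 5) hi2,
    integral_const_mul, integral_add hLs hVs,
    integral_sub hLi (integrable_const _), integral_sub hVi (integrable_const _), integral_div,
    integral_add hLi (integrable_const _), hLint, hVint]
  simp only [integral_const, probReal_univ, smul_eq_mul, one_mul]
  ring

end Likelihood

/-! ### Averaging over the arms and choice of the gap -/

/-- In the base instance some arm is played at most `K / A ^ (n + 1)` times in expectation; with
this arm as the distinguished one the regret is large. -/
theorem exists_arm_expectedRegret_ge {A n K : ℕ} {Ω : Type*} [MeasurableSpace Ω] (hA : 0 < A)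
    (hH : 0 < n + 1) {τ ε : ℝ} (hτ1 : τ < 1)
    (hε0 : 0 ≤ ε) (hε : ε < τ) (μ : Measure Ω) [IsProbabilityMeasure μ]
    (alg : Algorithm (TreeState A (n + 1)) (Fin A) Ω (n + 1) K) :
    ∃ w : Fin (n + 1) → Fin A,
      ε / τ *
          (K - ((1 + 5 * K * (ε ^ 2 / ((1 - τ + ε) * (τ - ε)))) * K / (A : ℝ) ^ (n + 1) + K / 5))
        ≤ (treeMDP hH (armSuccess τ ε w)).expectedRegret τ μ alg := by
  have hτ0 : 0 < τ := hε0.trans_lt hε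
  have hχ : 0 ≤ ε ^ 2 / ((1 - τ + ε) * (τ - ε)) :=
    div_nonneg (sq_nonneg _) (mul_nonneg (by linarith) (by linarith))
  have : Nonempty (Fin A) := ⟨⟨0, hA⟩⟩
  set P := (treeMDP hH (baseSuccess A n τ)).learningLaw μ alg K le_rfl
  have hsum : ∑ w : Fin (n + 1) → Fin A, ∫ x, armCount alg w K le_rfl x ∂P ≤ K := by
    rw [← integral_finsetSum _ fun w _ => integrable_armCount alg w K le_rfl P]
    calc _ ≤ ∫ x, (K : ℝ) ∂P := integral_mono
          (integrable_finsetSum _ fun w _ => integrable_armCount alg w K le_rfl P)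
          (integrable_const _) (sum_armCount_le alg K le_rfl)
      _ = K := by simp
  obtain ⟨w, -, hw⟩ : ∃ w ∈ (Finset.univ : Finset (Fin (n + 1) → Fin A)),
      ∫ x, armCount alg w K le_rfl x ∂P ≤ K / (A : ℝ) ^ (n + 1) := by
    refine Finset.exists_le_of_sum_le Finset.univ_nonempty (hsum.trans (le_of_eq ?_))
    have hA' : (A : ℝ) ≠ 0 := by positivity
    simp only [Finset.sum_const, Finset.card_univ, Fintype.card_fun, Fintype.card_fin,
      nsmul_eq_mul]
    push_cast
    field_simp
  refine ⟨w, ?_⟩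
  rw [expectedRegret_armSuccess hH hτ1 hε0 hε]
  have h1 := integral_armCount_armSuccess_le hH hτ1 hε0 hε w μ alg
  have h2 := mul_le_mul_of_nonneg_left hw
    (by positivity : 0 ≤ 1 + 5 * K * (ε ^ 2 / ((1 - τ + ε) * (τ - ε))))
  rw [← mul_div_assoc _ (K : ℝ)] at h2
  refine mul_le_mul_of_nonneg_left ?_ (by positivity)
  linarith

/-- The gap `ε = √(τ (N - 1) / K) / 10` makes the regret bound with `N` arms of the stated order:
the regret of missing the distinguished arm grows with `ε`, while the information
`K ε ^ 2 / (τ N)` about it stays bounded. -/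
theorem regret_bound_of_gap {τ N K : ℝ} (hτ0 : 0 < τ) (hτ : τ < 1 / 2) (hN : 2 ≤ N)
    (hK : (N - 1) / (8 * τ) ≤ K) :
    ∃ ε, 0 ≤ ε ∧ ε < τ ∧ 1 / (24 * Real.exp 1) * √((N - 1) * K / τ) ≤
      ε / τ * (K - ((1 + 5 * K * (ε ^ 2 / ((1 - τ + ε) * (τ - ε)))) * K / N + K / 5)) := by
  have hK0 : 0 < K := lt_of_lt_of_le (div_pos (by linarith) (by linarith)) hK
  have hKN : N - 1 ≤ 8 * τ * K := by rwa [div_le_iff₀' (by linarith)] at hK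
  set s := √(τ * (N - 1) / K) with hs
  have hs0 : 0 ≤ s := Real.sqrt_nonneg _
  have hs2 : s ^ 2 = τ * (N - 1) / K := Real.sq_sqrt (div_nonneg (by nlinarith) hK0.le)
  have hs2K : s ^ 2 * K = τ * (N - 1) := by rw [hs2]; field_simp
  -- The lower bound on `K` gives `s ^ 2 ≤ 8 * τ ^ 2`, so the gap `s / 10` is at most `3 * τ / 10`.
  have hs3 : s ≤ 3 * τ := by
    have : s ^ 2 ≤ (3 * τ) ^ 2 := by
      rw [hs2, div_le_iff₀ hK0]
      nlinarith [mul_pos hτ0 hτ0]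
    exact (pow_le_pow_iff_left₀ hs0 (by linarith) two_ne_zero).1 this
  have hsqrt : √((N - 1) * K / τ) = s * K / τ := by
    rw [show (N - 1) * K / τ = (s * K / τ) ^ 2 by
      rw [div_pow, mul_pow, hs2]; field_simp]
    exact Real.sqrt_sq (by positivity)
  refine ⟨s / 10, by positivity, by linarith, ?_⟩
  have hχ : (s / 10) ^ 2 / ((1 - τ + s / 10) * (τ - s / 10)) ≤ (N - 1) / (35 * K) := by
    -- Here `1 - τ + s / 10 ≥ 1 / 2` and `τ - s / 10 ≥ 7 * τ / 10`.
    have hden : 7 / 20 * τ ≤ (1 - τ + s / 10) * (τ - s / 10) := by nlinarith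
    rw [div_le_div_iff₀ (by nlinarith) (by positivity)]
    nlinarith
  have hbr : 8 / 35 * K ≤
      K - ((1 + 5 * K * ((s / 10) ^ 2 / ((1 - τ + s / 10) * (τ - s / 10)))) * K / N + K / 5) := by
    have h1 : 5 * K * ((s / 10) ^ 2 / ((1 - τ + s / 10) * (τ - s / 10))) ≤ (N - 1) / 7 := by
      calc _ ≤ 5 * K * ((N - 1) / (35 * K)) := by gcongr
        _ = (N - 1) / 7 := by field_simp; ring
    -- `(1 + (N - 1) / 7) / N` is largest at `N = 2`.
    have h2 : (1 + 5 * K * ((s / 10) ^ 2 / ((1 - τ + s / 10) * (τ - s / 10)))) * K / N ≤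
        4 / 7 * K := by
      rw [div_le_iff₀ (by linarith)]
      nlinarith
    linarith
  have he : 1 / (24 * Real.exp 1) ≤ 4 / 175 := by
    rw [div_le_div_iff₀ (by positivity) (by norm_num)]
    linarith [Real.exp_one_gt_d9]
  calc 1 / (24 * Real.exp 1) * √((N - 1) * K / τ) ≤ 4 / 175 * (s * K / τ) := by
        rw [hsqrt]; gcongr
    _ = s / 10 / τ * (8 / 35 * K) := by ring
    _ ≤ _ := mul_le_mul_of_nonneg_left hbr (by positivity)

theorem card_treeState (A H : ℕ) :
    Fintype.card (TreeState A H) = ∑ i ∈ Finset.range H, A ^ i := by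
  rw [← Fin.sum_univ_eq_sum_range fun i => A ^ i]
  exact (Fintype.card_sigma).trans (by simp)

theorem sum_range_pow_le_two_mul {A : ℕ} (hA : 2 ≤ A) (n : ℕ) :
    ∑ i ∈ Finset.range (n + 1), A ^ i ≤ 2 * A ^ n := by
  induction n with
  | zero => simp
  | succ n ih =>
    rw [Finset.sum_range_succ]
    have : 2 * A ^ n ≤ A ^ (n + 1) := by
      rw [pow_succ']
      exact Nat.mul_le_mul_right _ hA
    omega

end CVaRRL

end

theorem mainTheorem2 (τ : ℝ) (hτ0 : 0 < τ) (hτ : τ < 1 / 2)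
    (A H : ℕ) (hA : 0 < A) (hH : 0 < H) :
    Fintype.card (CVaRRL.TreeState A H) = ∑ i ∈ Finset.range H, A ^ i ∧
    A ^ (H - 1) ≤ Fintype.card (CVaRRL.TreeState A H) ∧
    (2 ≤ A → Fintype.card (CVaRRL.TreeState A H) ≤ 2 * A ^ (H - 1)) ∧
    ∀ (K : ℕ),
      (Fintype.card (CVaRRL.TreeState A H) : ℝ) * ((A : ℝ) - 1) / (8 * τ) ≤ (K : ℝ) →
      ∀ (Ω : Type*) [MeasurableSpace Ω] (μ : Measure Ω) [IsProbabilityMeasure μ]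
        (alg : CVaRRL.Algorithm (CVaRRL.TreeState A H) (Fin A) Ω H K),
        ∃ p : CVaRRL.TreeState A H → Fin A → unitInterval,
          (CVaRRL.treeMDP hH p).Normalized ∧
          1 / (24 * Real.exp 1) *
              √((Fintype.card (CVaRRL.TreeState A H) : ℝ) * ((A : ℝ) - 1) * (K : ℝ) / τ) ≤
            (CVaRRL.treeMDP hH p).expectedRegret τ μ alg := by
  obtain ⟨n, rfl⟩ : ∃ n, H = n + 1 := ⟨H - 1, by omega⟩
  have hτ1 : τ < 1 := by linarith
  rw [CVaRRL.card_treeState, Nat.add_sub_cancel]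
  refine ⟨rfl, Finset.single_le_sum (f := fun i => A ^ i) (fun i _ => Nat.zero_le _)
    (Finset.self_mem_range_succ n), fun hA2 => CVaRRL.sum_range_pow_le_two_mul hA2 n, ?_⟩
  intro K hK Ω _ μ _ alg
  -- The number of arms is `A ^ (n + 1) = S (A - 1) + 1`.
  have hgeom : ((∑ i ∈ Finset.range (n + 1), A ^ i : ℕ) : ℝ) * ((A : ℝ) - 1) =
      (A : ℝ) ^ (n + 1) - 1 := by
    push_cast
    exact geom_sum_mul _ _
  rw [hgeom] at hK ⊢
  rcases Nat.lt_or_ge A 2 with hA2 | hA2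
  · -- With a single arm the bound is zero, and so is the regret.
    obtain rfl : A = 1 := by omega
    refine ⟨CVaRRL.armSuccess τ 0 fun _ => 0,
      CVaRRL.normalized_armSuccess hH hτ1 le_rfl hτ0 _, ?_⟩
    rw [CVaRRL.expectedRegret_armSuccess hH hτ1 le_rfl hτ0]
    simp
  · have hN : (2 : ℝ) ≤ (A : ℝ) ^ (n + 1) := by
      have h2 : (2 : ℝ) ≤ A := by exact_mod_cast hA2
      exact h2.trans (le_self_pow₀ (by linarith) (Nat.succ_ne_zero n))
    obtain ⟨ε, hε0, hε, hbound⟩ := CVaRRL.regret_bound_of_gap hτ0 hτ hN hK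
    obtain ⟨w, hw⟩ := CVaRRL.exists_arm_expectedRegret_ge hA hH hτ1 hε0 hε μ alg
    exact ⟨CVaRRL.armSuccess τ ε w, CVaRRL.normalized_armSuccess hH hτ1 hε0 hε w, hbound.trans hw⟩
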